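/- Let $a,b,c\in\mathbb R$ with $b\neq 0$ be such that $A=2\begin{pmatrix}a&b\\ b&c\end{pmatrix}$ is (symmetric) positive definite. For a measurable set $E\subset\mathbb R^2$ let $$d\gamma_A(x)=\frac{\sqrt{\det A}}{2\pi}\,e^{-\langle Ax,x\rangle/2}\,dx,\qquad b_{\gamma_A}(E)=\int_E x\,d\gamma_A(x),\qquad P_{\gamma_A}(E)=\frac{\sqrt{\det A}}{\sqrt{2\pi}}\int_{\partial^M E}e^{-\langle Ax,x\rangle/2}\,d\mathcal H^1(x),$$ where $\partial^M E$ is the essential boundary of $E$, i.e. the set of points at which $E$ has neither Lebesgue density $0$ nor Lebesgue density $1$. For $z\in\mathbb R$ let $\mu_z(F)=\int_F e^{-\langle A(z,y),(z,y)\rangle/2}\,dy$ for measurable $F\subset\mathbb R$, let $\phi_z(t)=\mu_z((-\infty,t))$, an increasing bijection from $[-\infty,\infty]$ onto $[0,\mu_z(\mathbb R)]$, and let $$E^s=\{(z,y)\in\mathbb R^2:\ y<\phi_z^{-1}(\mu_z(E_z))\},\qquad E_z=\{y\in\mathbb R:(z,y)\in E\},$$ be the Ehrhard symmetrization of $E$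 in the $y$-direction. Let $E_\alpha=[-\alpha,\alpha]\times(0,\infty)$ and $e_2=(0,1)$. Then there is $\delta>0$ (depending only on $A$) such that for all $0<\alpha<\delta$ $$P_{\gamma_A}(E_\alpha)<P_{\gamma_A}(E_\alpha^s)$$ and $$P_{\gamma_A}(E_\alpha^s)<P_{\gamma_A}(E_\alpha)+\sqrt{2\pi}\,\bigl\|Ae_2-\langle Ae_2,e_2\rangle e_2\bigr\|\,\bigl\langle b_{\gamma_A}(E_\alpha)-b_{\gamma_A}(E_\alpha^s),e_2\bigr\rangle .$$ -/

import Mathlib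

open MeasureTheory Filter Topology
open scoped ENNReal

noncomputable section

namespace AnisoGauss

/-- The Euclidean plane `ℝ²`. -/
abbrev Plane : Type := EuclideanSpace ℝ (Fin 2)

/-- The second standard basis vector `e₂`. -/
def e₂ : Plane := !₂[0, 1]

/-- The matrix `A` acting on the Euclidean plane, `x ↦ A x`. -/
abbrev act (A : Matrix (Fin 2) (Fin 2) ℝ) (x : Plane) : Plane :=
  Matrix.toEuclideanLin A x

/-- The weight `exp (-⟨A x, x⟩ / 2)`. -/
def weight (A : Matrix (Fin 2) (Fin 2) ℝ) (x : Plane) : ℝ :=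
  Real.exp (-(inner ℝ (act A x) x) / 2)

/-- The anisotropic Gaussian measure
`γ_A(E) = √(det A) / (2π)^(n/2) · ∫_E exp (-⟨A x, x⟩ / 2) dx`, for `n = 2`. -/
def gaussMeasure (A : Matrix (Fin 2) (Fin 2) ℝ) : Measure Plane :=
  volume.withDensity fun x =>
    ENNReal.ofReal (Real.sqrt A.det / (2 * Real.pi) * weight A x)

/-- The (non-renormalized) barycenter `b_{γ_A}(E) = ∫_E x dγ_A(x)`. -/
def barycenter (A : Matrix (Fin 2) (Fin 2) ℝ) (E : Set Plane) : Plane :=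
  ∫ x in E, x ∂(gaussMeasure A)

/-- The square centered at `x` with sides of length `2ρ` parallel to the axes. -/
def cube (x : Plane) (ρ : ℝ) : Set Plane := {y | ∀ i, |y i - x i| ≤ ρ}

/-- The set `E^{(d)}` of points of density `d` of `E`. -/
def densityPoints (E : Set Plane) (d : ℝ≥0∞) : Set Plane :=
  {x | Tendsto (fun ρ : ℝ => volume (E ∩ cube x ρ) / volume (cube x ρ)) (𝓝[>] 0) (𝓝 d)}

/-- The essential boundary `∂^M E = ℝ² \ (E^{(0)} ∪ E^{(1)})`. -/
def essBoundary (E : Set Plane) : Set Plane := (densityPoints E 0 ∪ densityPoints E 1)ᶜ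

/-- The anisotropic Gaussian perimeter
`P_{γ_A}(E) = √(det A) / (2π)^((n-1)/2) · ∫_{∂^M E} exp (-⟨A x, x⟩ / 2) dH^{n-1}(x)`, for `n = 2`,
with values in `[0, ∞]`. (Mathlib's `μH[1]` is the usual one-dimensional Hausdorff measure: it
gives a segment its length.) -/
def perimeter (A : Matrix (Fin 2) (Fin 2) ℝ) (E : Set Plane) : ℝ≥0∞ :=
  ENNReal.ofReal (Real.sqrt A.det / Real.sqrt (2 * Real.pi)) *
    ∫⁻ x in essBoundary E, ENNReal.ofReal (weight A x) ∂(Measure.hausdorffMeasure 1)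

/-- The measure `μ_z(F) = ∫_F exp (-⟨A (z, y), (z, y)⟩ / 2) dy` on the vertical line over `z`. -/
def sliceMeasure (A : Matrix (Fin 2) (Fin 2) ℝ) (z : ℝ) : Measure ℝ :=
  volume.withDensity fun y => ENNReal.ofReal (weight A !₂[z, y])

/-- The vertical section `E_z = {y | (z, y) ∈ E}`. -/
def slice (E : Set Plane) (z : ℝ) : Set ℝ := {y | !₂[z, y] ∈ E}

/-- `v_E(z) = μ_z(E_z)`. -/
def sliceMass (A : Matrix (Fin 2) (Fin 2) ℝ) (E : Set Plane) (z : ℝ) : ℝ≥0∞ :=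
  sliceMeasure A z (slice E z)

/-- `φ_z(t) = ∫_{-∞}^t exp (-⟨A (z, y), (z, y)⟩ / 2) dy` for `t ∈ [-∞, ∞]`. -/
def phi (A : Matrix (Fin 2) (Fin 2) ℝ) (z : ℝ) (t : EReal) : ℝ≥0∞ :=
  sliceMeasure A z {y | (y : EReal) < t}

/-- The inverse `φ_z⁻¹ : [0, μ_z(ℝ)] → [-∞, ∞]` of the increasing bijection `φ_z`, written as
`φ_z⁻¹(m) = sup {t | φ_z(t) ≤ m}`. In particular `φ_z⁻¹(0) = -∞` and `φ_z⁻¹(μ_z(ℝ)) = ∞`. -/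
def phiInv (A : Matrix (Fin 2) (Fin 2) ℝ) (z : ℝ) (m : ℝ≥0∞) : EReal :=
  sSup {t : EReal | phi A z t ≤ m}

/-- The Ehrhard symmetrization
`E^s = {(z, y) | y < φ_z⁻¹(v_E(z))}` with respect to the `y`-direction. -/
def ehrhardSymm (A : Matrix (Fin 2) (Fin 2) ℝ) (E : Set Plane) : Set Plane :=
  {x | (x 1 : EReal) < phiInv A (x 0) (sliceMass A E (x 0))}

/-- The half-strip `E_α = [-α, α] × (0, ∞)`. -/
def halfStrip (α : ℝ) : Set Plane := {x | x 0 ∈ Set.Icc (-α) α ∧ x 1 ∈ Set.Ioi (0 : ℝ)}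

end AnisoGauss

end

namespace AnisoGauss

/-! ### Densities -/

/-! On the vertical line over `z` the weight is a Gaussian in `y` centred at `-b z / c`, so the
reflection `y ↦ k z - y` with `k = -2 b / c` preserves `μ_z`. It carries `(0, ∞)` to `(-∞, k z)`;
hence `E_α^s` is the part of the strip below the oblique line `y = k z` (`ehrhardSymm_halfStrip`).

The reflection also matches the vertical sides of the two sets, whose total weighted length is a
common number `V`. The weight on both bases is `exp (-a z²)`; only the length element differs, by
the factor `√(1 + k²)`. With `J = ∫_{-α}^{α} exp (-a z²) dz` and `K = √(det A) / √(2π)`, the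
perimeters are `K (J + V)` and `K (√(1 + k²) J + V)` (`perimeter_halfStrip`,
`perimeter_ehrhardSymm_halfStrip`).

Reflecting `E_α^s` back onto `E_α` turns the barycenter difference into the integral of `2 y - k z`
over `E_α`. In `y` this integrand is an exact derivative, and the outcome is `J / c` up to
normalization (`barycenter_diff`). The correction term of the theorem is therefore `K |k| J`, and
everything reduces to `1 < √(1 + k²) < 1 + |k|` for `k ≠ 0`. -/

lemma cube_eq_preimage (x : Plane) {ρ : ℝ} (hρ : 0 ≤ ρ) :
    cube x ρ = WithLp.ofLp ⁻¹' Metric.closedBall (WithLp.ofLp x) ρ := by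
  ext y
  simp [cube, dist_pi_le_iff hρ, Real.dist_eq]

lemma volume_cube (x : Plane) {ρ : ℝ} (hρ : 0 ≤ ρ) :
    volume (cube x ρ) = ENNReal.ofReal ((2 * ρ) ^ 2) := by
  rw [cube_eq_preimage x hρ, (PiLp.volume_preserving_ofLp (Fin 2)).measure_preimage
    measurableSet_closedBall.nullMeasurableSet, Real.volume_pi_closedBall _ hρ]
  simp

lemma measurableSet_cube (x : Plane) {ρ : ℝ} (hρ : 0 ≤ ρ) : MeasurableSet (cube x ρ) := by
  rw [cube_eq_preimage x hρ]
  exact (PiLp.volume_preserving_ofLp (Fin 2)).measurable measurableSet_closedBall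

lemma volume_subcube_div {x y : Plane} {ε ρ : ℝ} (hε : 0 < ε) (hρ : 0 < ρ) :
    volume (cube y (ε * ρ)) / volume (cube x ρ) = ENNReal.ofReal (ε ^ 2) := by
  rw [volume_cube _ (by positivity), volume_cube _ hρ.le,
    ← ENNReal.ofReal_div_of_pos (by positivity)]
  congr 1
  field_simp

/-- A set containing, at every small scale around `x`, a cube of comparable size does not have
density `0` at `x`. -/
lemma notMem_densityPoints_zero {E : Set Plane} {x v : Plane} {ε ρ₀ : ℝ} (hε : 0 < ε)
    (hρ₀ : 0 < ρ₀)
    (h : ∀ ρ, 0 < ρ → ρ < ρ₀ → cube (x + ρ • v) (ε * ρ) ⊆ E ∩ cube x ρ) :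
    x ∉ densityPoints E 0 := by
  intro hx
  have hle : ENNReal.ofReal (ε ^ 2) ≤ 0 := by
    refine ge_of_tendsto hx ?_
    filter_upwards [Ioo_mem_nhdsGT hρ₀] with ρ hρ
    rw [← volume_subcube_div (x := x) (y := x + ρ • v) hε hρ.1]
    exact ENNReal.div_le_div_right (measure_mono (h ρ hρ.1 hρ.2)) _
  have : 0 < ENNReal.ofReal (ε ^ 2) := ENNReal.ofReal_pos.2 (by positivity)
  exact absurd hle this.not_ge

/-- A set whose complement contains, at every small scale around `x`, a cube of comparable size
does not have density `1` at `x`. -/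
lemma notMem_densityPoints_one {E : Set Plane} {x v : Plane} {ε ρ₀ : ℝ} (hε : 0 < ε)
    (hρ₀ : 0 < ρ₀)
    (h : ∀ ρ, 0 < ρ → ρ < ρ₀ → cube (x + ρ • v) (ε * ρ) ⊆ Eᶜ ∩ cube x ρ) :
    x ∉ densityPoints E 1 := by
  intro hx
  have hle : 1 ≤ 1 - ENNReal.ofReal (ε ^ 2) := by
    refine le_of_tendsto hx ?_
    filter_upwards [Ioo_mem_nhdsGT hρ₀] with ρ hρ
    have hv : volume (cube x ρ) ≠ 0 := by
      rw [volume_cube _ hρ.1.le]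
      simpa using hρ.1.ne'
    have hv' : volume (cube x ρ) ≠ ∞ := by
      rw [volume_cube _ hρ.1.le]
      exact ENNReal.ofReal_ne_top
    have hsub := h ρ hρ.1 hρ.2
    have hfin : volume (cube (x + ρ • v) (ε * ρ)) ≠ ∞ :=
      ne_top_of_le_ne_top hv' (measure_mono (hsub.trans Set.inter_subset_right))
    have h1 : volume (E ∩ cube x ρ) ≤ volume (cube x ρ) - volume (cube (x + ρ • v) (ε * ρ)) := by
      rw [← measure_sdiff (hsub.trans Set.inter_subset_right)
        (measurableSet_cube _ (mul_pos hε hρ.1).le).nullMeasurableSet hfin]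
      exact measure_mono fun y hy => ⟨hy.2, fun hy' => (hsub hy').1 hy.1⟩
    calc volume (E ∩ cube x ρ) / volume (cube x ρ)
        ≤ (volume (cube x ρ) - volume (cube (x + ρ • v) (ε * ρ))) / volume (cube x ρ) :=
          ENNReal.div_le_div_right h1 _
      _ = 1 - ENNReal.ofReal (ε ^ 2) := by
          rw [ENNReal.sub_div fun _ _ => hv, ENNReal.div_self hv hv', volume_subcube_div hε hρ.1]
  have : 0 < ENNReal.ofReal (ε ^ 2) := ENNReal.ofReal_pos.2 (by positivity)
  exact absurd hle (ENNReal.sub_lt_self ENNReal.one_ne_top one_ne_zero this.ne').not_ge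

lemma eventually_cube_subset {E : Set Plane} {x : Plane} (h : E ∈ 𝓝 x) :
    ∀ᶠ ρ in 𝓝[>] (0 : ℝ), cube x ρ ⊆ E := by
  obtain ⟨r, hr, hrE⟩ := Metric.mem_nhds_iff.1 h
  filter_upwards [Ioo_mem_nhdsGT (half_pos hr)] with ρ hρ y hy
  refine hrE ?_
  have h0 := abs_le.1 (hy 0)
  have h1 := abs_le.1 (hy 1)
  rw [Metric.mem_ball, EuclideanSpace.dist_eq, Fin.sum_univ_two, Real.dist_eq, Real.dist_eq,
    sq_abs, sq_abs, Real.sqrt_lt' hr]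
  nlinarith [hρ.1, hρ.2]

lemma mem_densityPoints_one {E : Set Plane} {x : Plane} (h : E ∈ 𝓝 x) :
    x ∈ densityPoints E 1 := by
  refine tendsto_const_nhds.congr' ?_
  filter_upwards [eventually_cube_subset h, self_mem_nhdsWithin] with ρ hρ hρ0
  have hρ0 : 0 < ρ := hρ0
  rw [Set.inter_eq_right.2 hρ, ENNReal.div_self]
  · rw [volume_cube _ hρ0.le]
    simpa using hρ0.ne'
  · rw [volume_cube _ hρ0.le]
    exact ENNReal.ofReal_ne_top

lemma mem_densityPoints_zero {E : Set Plane} {x : Plane} (h : Eᶜ ∈ 𝓝 x) :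
    x ∈ densityPoints E 0 := by
  refine tendsto_const_nhds.congr' ?_
  filter_upwards [eventually_cube_subset h] with ρ hρ
  rw [(Set.disjoint_left.2 fun y hy hy' => hρ hy' hy : Disjoint E (cube x ρ)).inter_eq]
  simp

/-! ### Half-strips bounded by an oblique segment -/

/-- The half-strip over `[-α, α]` on the side `s = ±1` of the line `y = k z`. -/
def obliqueStrip (α k s : ℝ) : Set Plane :=
  {x | x 0 ∈ Set.Icc (-α) α ∧ 0 < s * (x 1 - k * x 0)}

/-- The open bounded side of an oblique half-strip. -/
def stripBase (α k : ℝ) : Set Plane := {x | x 0 ∈ Set.Ioo (-α) α ∧ x 1 = k * x 0}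

/-- The open vertical side over `β` of an oblique half-strip. -/
def stripSide (k s β : ℝ) : Set Plane := {x | x 0 = β ∧ 0 < s * (x 1 - k * x 0)}

lemma continuous_coord (i : Fin 2) : Continuous fun x : Plane => x i := by fun_prop

lemma stripBase_subset_essBoundary {α k s : ℝ} (hs : s ^ 2 = 1) :
    stripBase α k ⊆ essBoundary (obliqueStrip α k s) := by
  rintro x ⟨⟨h1, h2⟩, hx⟩
  have hk := abs_nonneg k
  -- The test cubes are centred at distance `ρ / 2` above or below `x`. This `ε` makes `y - k z`
  -- vary by at most `ρ / 4` around its central value `± ρ / 2`, so a cube never crosses the line.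
  set ε : ℝ := 1 / (4 * (1 + |k|)) with hεdef
  have hε : 0 < ε := by positivity
  have hε' : ε * (1 + |k|) = 1 / 4 := by rw [hεdef]; field_simp
  have hε1 : ε ≤ 1 / 4 := by nlinarith
  have hs1 : |s| = 1 := by rwa [← sq_eq_sq₀ (abs_nonneg s) zero_le_one, sq_abs, one_pow]
  set ρ₀ : ℝ := min (α - x 0) (x 0 + α) with hρ₀
  have hρ₀pos : 0 < ρ₀ := lt_min (by linarith) (by linarith)
  -- Used with `σ = s` for a cube inside the strip and `σ = -s` for one outside.
  have key : ∀ σ : ℝ, ∀ ρ, 0 < ρ → ∀ y ∈ cube (x + ρ • (!₂[0, σ / 2] : Plane)) (ε * ρ),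
      |y 0 - x 0| ≤ ε * ρ ∧ |y 1 - x 1 - ρ * σ / 2| ≤ ε * ρ ∧
      |s * (y 1 - x 1 - ρ * σ / 2) - s * k * (y 0 - x 0)| ≤ ρ / 4 := by
    intro σ ρ hρ y hy
    have hy0 := hy 0
    have hy1 := hy 1
    simp only [PiLp.add_apply, PiLp.smul_apply, smul_eq_mul, Matrix.cons_val_zero,
      Matrix.cons_val_one, mul_zero, add_zero] at hy0 hy1
    have hy1' : |y 1 - x 1 - ρ * σ / 2| ≤ ε * ρ := by convert hy1 using 2; ring
    refine ⟨hy0, hy1', (abs_sub _ _).trans ?_⟩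
    rw [abs_mul, abs_mul, abs_mul, hs1]
    nlinarith [mul_le_mul_of_nonneg_left hy0 hk]
  rintro (h | h)
  · refine notMem_densityPoints_zero (v := !₂[0, s / 2]) hε hρ₀pos (fun ρ hρ hρ' y hy => ?_) h
    obtain ⟨k0, k1, k2⟩ := key s ρ hρ y hy
    have l1 := hρ'.trans_le (min_le_left _ _)
    have l2 := hρ'.trans_le (min_le_right _ _)
    have hερ : ε * ρ ≤ ρ / 4 := by nlinarith
    obtain ⟨a0, a1⟩ := abs_le.1 k0
    obtain ⟨b0, b1⟩ := abs_le.1 k1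
    have hsl := abs_le.1 (show |s| ≤ 1 from hs1.le)
    refine ⟨⟨⟨by linarith, by linarith⟩, ?_⟩, fun i => ?_⟩
    · have : s * (y 1 - k * y 0) =
          s * (y 1 - x 1 - ρ * s / 2) - s * k * (y 0 - x 0) + ρ / 2 := by
        rw [hx]; linear_combination (ρ / 2) * hs
      rw [this]
      linarith [(abs_le.1 k2).1]
    · fin_cases i
      · exact k0.trans (by linarith)
      · refine abs_le.2 ⟨?_, ?_⟩ <;> simp only [Fin.mk_one] <;> nlinarith
  · refine notMem_densityPoints_one (v := !₂[0, (-s) / 2]) hε hρ₀pos (fun ρ hρ hρ' y hy => ?_) h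
    obtain ⟨k0, k1, k2⟩ := key (-s) ρ hρ y hy
    have hερ : ε * ρ ≤ ρ / 4 := by nlinarith
    obtain ⟨b0, b1⟩ := abs_le.1 k1
    have hsl := abs_le.1 (show |s| ≤ 1 from hs1.le)
    refine ⟨fun hyE => ?_, fun i => ?_⟩
    · have : s * (y 1 - k * y 0) =
          s * (y 1 - x 1 - ρ * (-s) / 2) - s * k * (y 0 - x 0) - ρ / 2 := by
        rw [hx]; linear_combination (-ρ / 2) * hs
      have h3 := hyE.2
      rw [this] at h3
      linarith [(abs_le.1 k2).2]
    · fin_cases i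
      · exact k0.trans (by linarith)
      · refine abs_le.2 ⟨?_, ?_⟩ <;> simp only [Fin.mk_one] <;> nlinarith

lemma stripSide_subset_essBoundary {α k s σ : ℝ} (hα : 0 < α) (hs : s ^ 2 = 1) (hσ : σ ^ 2 = 1) :
    stripSide k s (σ * α) ⊆ essBoundary (obliqueStrip α k s) := by
  rintro x ⟨hx0, hx⟩
  have hk := abs_nonneg k
  have hs1 : |s| = 1 := by rwa [← sq_eq_sq₀ (abs_nonneg s) zero_le_one, sq_abs, one_pow]
  -- Here the test cubes move horizontally, inwards or outwards. Moving by at most `ρ` in each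
  -- coordinate changes `y - k z` by at most `(1 + |k|) ρ`, so below this scale the inner cube stays
  -- on the correct side of the oblique line; the bound by `α` keeps it from reaching the opposite
  -- side.
  set ρ₀ : ℝ := min α (s * (x 1 - k * x 0) / (1 + |k|)) with hρ₀
  have hρ₀pos : 0 < ρ₀ := lt_min hα (by positivity)
  have key : ∀ τ : ℝ, |τ| ≤ 1 → ∀ ρ, 0 < ρ → ∀ y ∈ cube (x + ρ • (!₂[τ / 2, 0] : Plane)) (1 / 4 * ρ),
      |y 0 - x 0 - ρ * τ / 2| ≤ ρ / 4 ∧ |y 0 - x 0| ≤ ρ ∧ |y 1 - x 1| ≤ ρ := by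
    intro τ hτ ρ hρ y hy
    have hy0 := hy 0
    have hy1 := hy 1
    simp only [PiLp.add_apply, PiLp.smul_apply, smul_eq_mul, Matrix.cons_val_zero,
      Matrix.cons_val_one, mul_zero, add_zero] at hy0 hy1
    have hy0' : |y 0 - x 0 - ρ * τ / 2| ≤ ρ / 4 := by
      convert hy0 using 1 <;> ring_nf
    obtain ⟨a0, a1⟩ := abs_le.1 hy0'
    obtain ⟨t0, t1⟩ := abs_le.1 hτ
    exact ⟨hy0', abs_le.2 ⟨by nlinarith, by nlinarith⟩, hy1.trans (by linarith)⟩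
  have hσ1 : |σ| = 1 := by rwa [← sq_eq_sq₀ (abs_nonneg σ) zero_le_one, sq_abs, one_pow]
  rintro (h | h)
  · refine notMem_densityPoints_zero (v := !₂[(-σ) / 2, 0]) (by norm_num : (0 : ℝ) < 1 / 4) hρ₀pos
      (fun ρ hρ hρ' y hy => ?_) h
    obtain ⟨k0, k1, k2⟩ := key (-σ) (by rw [abs_neg, hσ1]) ρ hρ y hy
    have l1 := hρ'.trans_le (min_le_left _ _)
    have l2 := hρ'.trans_le (min_le_right _ _)
    rw [lt_div_iff₀ (by positivity)] at l2
    obtain ⟨a0, a1⟩ := abs_le.1 k0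
    refine ⟨⟨?_, ?_⟩, fun i => ?_⟩
    · rcases sq_eq_one_iff.1 hσ with rfl | rfl
      · constructor <;> linarith
      · constructor <;> linarith
    · have h3 : |s * (y 1 - x 1) - s * k * (y 0 - x 0)| ≤ ρ + |k| * ρ := by
        refine (abs_sub _ _).trans ?_
        rw [abs_mul, abs_mul, abs_mul, hs1]
        nlinarith [mul_le_mul_of_nonneg_left k1 hk]
      linarith [(abs_le.1 h3).1]
    · fin_cases i
      exacts [k1, k2]
  · refine notMem_densityPoints_one (v := !₂[σ / 2, 0]) (by norm_num : (0 : ℝ) < 1 / 4) hρ₀pos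
      (fun ρ hρ hρ' y hy => ?_) h
    obtain ⟨k0, k1, k2⟩ := key σ hσ1.le ρ hρ y hy
    obtain ⟨a0, a1⟩ := abs_le.1 k0
    refine ⟨fun hyE => ?_, fun i => ?_⟩
    · obtain ⟨⟨e0, e1⟩, -⟩ := hyE
      rcases sq_eq_one_iff.1 hσ with rfl | rfl <;> linarith
    · fin_cases i
      exacts [k1, k2]

/-- Exterior points have density `0` and interior points density `1`. The two corners need no
density computation: they are null for one-dimensional Hausdorff measure. -/
lemma essBoundary_obliqueStrip_subset {α k s : ℝ} (hs : s ^ 2 = 1) :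
    essBoundary (obliqueStrip α k s) ⊆
      (stripBase α k ∪ (stripSide k s α ∪ stripSide k s (-α))) ∪
        {!₂[α, k * α], !₂[-α, k * -α]} := by
  intro x hx
  have hc0 := continuous_coord 0
  have hc1 := continuous_coord 1
  have hx0 : x ∉ densityPoints (obliqueStrip α k s) 0 := fun h => hx (Or.inl h)
  have hx1 : x ∉ densityPoints (obliqueStrip α k s) 1 := fun h => hx (Or.inr h)
  have h1 : -α ≤ x 0 := by
    by_contra! h
    refine hx0 (mem_densityPoints_zero ?_)
    filter_upwards [(isOpen_lt hc0 continuous_const).mem_nhds h] with y hy hyE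
    exact absurd hyE.1.1 (not_le.2 hy)
  have h2 : x 0 ≤ α := by
    by_contra! h
    refine hx0 (mem_densityPoints_zero ?_)
    filter_upwards [(isOpen_lt continuous_const hc0).mem_nhds h] with y hy hyE
    exact absurd hyE.1.2 (not_le.2 hy)
  have hc : Continuous fun x : Plane => s * (x 1 - k * x 0) := by fun_prop
  have h3 : 0 ≤ s * (x 1 - k * x 0) := by
    by_contra! h
    refine hx0 (mem_densityPoints_zero ?_)
    filter_upwards [(isOpen_lt hc continuous_const).mem_nhds h] with y hy hyE
    exact lt_asymm hyE.2 hy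
  have h4 : ¬ (-α < x 0 ∧ x 0 < α ∧ 0 < s * (x 1 - k * x 0)) := by
    rintro ⟨g1, g2, g3⟩
    refine hx1 (mem_densityPoints_one ?_)
    filter_upwards [(isOpen_lt continuous_const hc0).mem_nhds g1,
      (isOpen_lt hc0 continuous_const).mem_nhds g2, (isOpen_lt continuous_const hc).mem_nhds g3]
      with y y1 y2 y3
    exact ⟨⟨le_of_lt y1, le_of_lt y2⟩, y3⟩
  have hs0 : s ≠ 0 := by rintro rfl; norm_num at hs
  have hcorner : ∀ β : ℝ, x 0 = β → x 1 = k * x 0 → x = !₂[β, k * β] := by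
    intro β hβ hb
    ext i
    fin_cases i
    · simpa using hβ
    · simpa [← hβ] using hb
  rcases h3.eq_or_lt with h3 | h3
  · have hb : x 1 = k * x 0 := by
      rcases mul_eq_zero.1 h3.symm with h | h
      exacts [absurd h hs0, sub_eq_zero.1 h]
    rcases h1.eq_or_lt with h1 | h1
    · exact Or.inr (Or.inr (hcorner _ h1.symm hb))
    rcases h2.eq_or_lt with h2 | h2
    · exact Or.inr (Or.inl (hcorner _ h2 hb))
    · exact Or.inl (Or.inl ⟨⟨h1, h2⟩, hb⟩)
  · rcases h1.eq_or_lt with h1 | h1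
    · exact Or.inl (Or.inr (Or.inr ⟨h1.symm, h3⟩))
    rcases h2.eq_or_lt with h2 | h2
    · exact Or.inl (Or.inr (Or.inl ⟨h2, h3⟩))
    · exact absurd ⟨h1, h2, h3⟩ h4

/-! ### One-dimensional Hausdorff measure on lines -/

/-- The unit-speed parametrization `ι` is an isometry, so it pushes Lebesgue measure to Hausdorff
measure on the line; rescaling the parameter gives the factor `‖w‖`. -/
lemma lintegral_hausdorffMeasure_line (p w : Plane) (hw : w ≠ 0) {T : Set ℝ} (hT : MeasurableSet T)
    {f : Plane → ℝ≥0∞} (hf : Measurable f) :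
    ∫⁻ x in (fun t : ℝ => p + t • w) '' T, f x ∂(Measure.hausdorffMeasure 1) =
      ENNReal.ofReal ‖w‖ * ∫⁻ t in T, f (p + t • w) := by
  have hw' : ‖w‖ ≠ 0 := norm_ne_zero_iff.2 hw
  set ι : ℝ → Plane := fun t => p + t • (‖w‖⁻¹ • w) with hι
  have hiso : Isometry ι := by
    refine Isometry.of_dist_eq fun s t => ?_
    rw [dist_eq_norm, dist_eq_norm, add_sub_add_left_eq_sub, ← sub_smul, norm_smul, norm_smul,
      norm_inv, norm_norm, inv_mul_cancel₀ hw', mul_one]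
  have himg : (fun t : ℝ => p + t • w) '' T = ι '' ((fun t => ‖w‖ * t) '' T) := by
    rw [Set.image_image]
    refine Set.image_congr fun t _ => ?_
    simp only [hι, smul_smul]
    field_simp
  have hemb : MeasurableEmbedding ι := hiso.isClosedEmbedding.measurableEmbedding
  have hT' : MeasurableSet ((fun t => ‖w‖ * t) '' T) :=
    (Homeomorph.mulLeft₀ ‖w‖ hw').measurableEmbedding.measurableSet_image.2 hT
  have hmap : Measure.map ι volume = (Measure.hausdorffMeasure 1).restrict (Set.range ι) := by
    rw [← hausdorffMeasure_real]
    exact hiso.map_hausdorffMeasure (Or.inl zero_le_one)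
  rw [himg, ← Set.inter_eq_left.2 (Set.image_subset_range ι ((fun t => ‖w‖ * t) '' T)),
    ← Measure.restrict_restrict (hemb.measurableSet_image.2 hT'), ← hmap,
    hemb.restrict_map, Set.preimage_image_eq _ hiso.injective, hemb.lintegral_map,
    lintegral_image_eq_lintegral_abs_deriv_mul (f' := fun _ => ‖w‖) hT
      (fun t _ => by simpa using ((hasDerivAt_id t).const_mul ‖w‖).hasDerivWithinAt)
      (fun s _ t _ h => mul_left_cancel₀ hw' h), abs_norm, lintegral_const_mul]
  · congr 1
    refine lintegral_congr fun t => ?_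
    congr 1
    simp only [hι, smul_smul]
    field_simp
  · fun_prop

lemma lintegral_stripBase (α k : ℝ) {f : Plane → ℝ≥0∞} (hf : Measurable f) :
    ∫⁻ x in stripBase α k, f x ∂(Measure.hausdorffMeasure 1) =
      ENNReal.ofReal (Real.sqrt (1 + k ^ 2)) * ∫⁻ z in Set.Ioo (-α) α, f !₂[z, k * z] := by
  have hvec : ∀ t : ℝ, (0 : Plane) + t • !₂[1, k] = !₂[t, k * t] := by
    intro t
    ext i
    fin_cases i <;> simp [mul_comm]
  have hw : (!₂[1, k] : Plane) ≠ 0 := fun h => by simpa using congrArg (fun x : Plane => x 0) h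
  have hset : stripBase α k = (fun t : ℝ => (0 : Plane) + t • !₂[1, k]) '' Set.Ioo (-α) α := by
    ext x
    simp only [stripBase, Set.mem_ofPred_eq, Set.mem_image, hvec]
    constructor
    · rintro ⟨h1, h2⟩
      refine ⟨x 0, h1, ?_⟩
      ext i
      fin_cases i <;> simp [h2]
    · rintro ⟨t, ht, rfl⟩
      exact ⟨by simpa using ht, by simp⟩
  rw [hset, lintegral_hausdorffMeasure_line _ _ hw measurableSet_Ioo hf]
  simp only [hvec]
  congr 3
  simp [EuclideanSpace.norm_eq]

lemma lintegral_stripSide (k s β : ℝ) {f : Plane → ℝ≥0∞} (hf : Measurable f) :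
    ∫⁻ x in stripSide k s β, f x ∂(Measure.hausdorffMeasure 1) =
      ∫⁻ t in {t | 0 < s * (t - k * β)}, f !₂[β, t] := by
  have hvec : ∀ t : ℝ, (!₂[β, 0] : Plane) + t • !₂[0, 1] = !₂[β, t] := by
    intro t
    ext i
    fin_cases i <;> simp
  have hw : (!₂[0, 1] : Plane) ≠ 0 := fun h => by simpa using congrArg (fun x : Plane => x 1) h
  have hset : stripSide k s β =
      (fun t : ℝ => (!₂[β, 0] : Plane) + t • !₂[0, 1]) '' {t | 0 < s * (t - k * β)} := by
    ext x
    simp only [stripSide, Set.mem_ofPred_eq, Set.mem_image, hvec]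
    constructor
    · rintro ⟨h1, h2⟩
      refine ⟨x 1, by rwa [← h1], ?_⟩
      ext i
      fin_cases i <;> simp [h1]
    · rintro ⟨t, ht, rfl⟩
      exact ⟨by simp, by simpa using ht⟩
  rw [hset, lintegral_hausdorffMeasure_line _ _ hw (measurableSet_lt (by fun_prop) (by fun_prop)) hf]
  simp only [hvec]
  simp [EuclideanSpace.norm_eq]

lemma measurableSet_stripSide (k s β : ℝ) : MeasurableSet (stripSide k s β) :=
  (measurableSet_eq_fun (continuous_coord 0).measurable measurable_const).inter
    (isOpen_lt continuous_const (g := fun x : Plane => s * (x 1 - k * x 0))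
      (by fun_prop)).measurableSet

/-- The integral over the essential boundary of an oblique half-strip is the sum of the integrals
over its three sides. -/
lemma lintegral_essBoundary_obliqueStrip {α k s : ℝ} (hα : 0 < α) (hs : s ^ 2 = 1)
    {f : Plane → ℝ≥0∞} (hf : Measurable f) :
    ∫⁻ x in essBoundary (obliqueStrip α k s), f x ∂(Measure.hausdorffMeasure 1) =
      ENNReal.ofReal (Real.sqrt (1 + k ^ 2)) * (∫⁻ z in Set.Ioo (-α) α, f !₂[z, k * z]) +
        ((∫⁻ t in {t | 0 < s * (t - k * α)}, f !₂[α, t]) +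
          ∫⁻ t in {t | 0 < s * (t - k * -α)}, f !₂[-α, t]) := by
  have : NullSingletonClass (Measure.hausdorffMeasure 1 : Measure Plane) :=
    Measure.nullSingletonClass_hausdorff Plane zero_lt_one
  have hae : essBoundary (obliqueStrip α k s) =ᵐ[Measure.hausdorffMeasure 1]
      (stripBase α k ∪ (stripSide k s α ∪ stripSide k s (-α)) : Set Plane) := by
    refine (ae_le_set.2 ?_).antisymm ?_
    · have h0 : (Measure.hausdorffMeasure 1 : Measure Plane)
          {!₂[α, k * α], !₂[-α, k * -α]} = 0 := (Set.toFinite _).measure_zero _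
      refine measure_mono_null (fun x hx => ?_) h0
      exact (essBoundary_obliqueStrip_subset hs hx.1).resolve_left hx.2
    · refine LE.le.eventuallyLE ?_
      have h1 := stripSide_subset_essBoundary (k := k) (σ := 1) hα hs (by norm_num)
      have h2 := stripSide_subset_essBoundary (k := k) (σ := -1) hα hs (by norm_num)
      rw [one_mul] at h1
      rw [neg_one_mul] at h2
      exact Set.union_subset (stripBase_subset_essBoundary hs) (Set.union_subset h1 h2)
  rw [setLIntegral_congr hae, lintegral_union
    ((measurableSet_stripSide k s α).union (measurableSet_stripSide k s (-α))),
    lintegral_union (measurableSet_stripSide k s (-α)),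
    lintegral_stripBase _ _ hf, lintegral_stripSide _ _ _ hf, lintegral_stripSide _ _ _ hf]
  · refine Set.disjoint_left.2 fun x hx hx' => ?_
    have h1 : x 0 = α := hx.1
    have h2 : x 0 = -α := hx'.1
    linarith
  · refine Set.disjoint_left.2 fun x hx hx' => ?_
    obtain ⟨⟨h1, h2⟩, -⟩ := hx
    rcases hx' with ⟨h, -⟩ | ⟨h, -⟩ <;> linarith

/-! ### The Gaussian weight -/

/-- The matrix with quadratic form `2 (a z² + 2 b z y + c y²)`. -/
def formMatrix (a b c : ℝ) : Matrix (Fin 2) (Fin 2) ℝ := (2 : ℝ) • !![a, b; b, c]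

lemma formMatrix_det (a b c : ℝ) : (formMatrix a b c).det = 4 * (a * c - b ^ 2) := by
  simp [formMatrix, Matrix.det_fin_two]
  ring

lemma weight_formMatrix (a b c : ℝ) (x : Plane) :
    weight (formMatrix a b c) x =
      Real.exp (-(a * x 0 ^ 2 + 2 * b * x 0 * x 1 + c * x 1 ^ 2)) := by
  simp only [weight, act, PiLp.inner_apply, Fin.sum_univ_two]
  simp [formMatrix, Matrix.toLpLin_apply, dotProduct, Fin.sum_univ_two]
  ring

lemma weight_formMatrix_mk (a b c z y : ℝ) :
    weight (formMatrix a b c) !₂[z, y] =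
      Real.exp (-(a * z ^ 2 + 2 * b * z * y + c * y ^ 2)) := by
  simp [weight_formMatrix]

lemma continuous_weight (a b c : ℝ) : Continuous (weight (formMatrix a b c)) := by
  simp_rw [funext (weight_formMatrix a b c)]
  fun_prop

lemma weight_pos (A : Matrix (Fin 2) (Fin 2) ℝ) (x : Plane) : 0 < weight A x := Real.exp_pos _

/-- The exponent is quadratic in `y` with axis of symmetry `y = -b z / c`. -/
lemma weight_reflect {a b c : ℝ} (hc : c ≠ 0) (z y : ℝ) :
    weight (formMatrix a b c) !₂[z, -2 * b / c * z - y] = weight (formMatrix a b c) !₂[z, y] := by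
  rw [weight_formMatrix_mk, weight_formMatrix_mk]
  congr 2
  field_simp
  ring

lemma continuous_weight_slice (a b c z : ℝ) :
    Continuous fun y => weight (formMatrix a b c) !₂[z, y] := by
  simp_rw [weight_formMatrix_mk]
  fun_prop

lemma integrable_weight_slice {a b c : ℝ} (hc : 0 < c) (z : ℝ) :
    Integrable fun y => weight (formMatrix a b c) !₂[z, y] := by
  have h := ((integrable_exp_neg_mul_sq hc).comp_add_right (b * z / c)).const_mul
    (Real.exp (-(a - b ^ 2 / c) * z ^ 2))
  refine h.congr (ae_of_all _ fun y => ?_)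
  simp only [weight_formMatrix_mk]
  rw [← Real.exp_add]
  congr 1
  field_simp
  ring

lemma measurable_ofReal_weight_slice (a b c z : ℝ) :
    Measurable fun y => ENNReal.ofReal (weight (formMatrix a b c) !₂[z, y]) :=
  (continuous_weight_slice a b c z).measurable.ennreal_ofReal

lemma isFiniteMeasure_sliceMeasure {a b c : ℝ} (hc : 0 < c) (z : ℝ) :
    IsFiniteMeasure (sliceMeasure (formMatrix a b c) z) :=
  isFiniteMeasure_withDensity_ofReal (integrable_weight_slice hc z).2

lemma setLIntegral_weight_reflect {a b c : ℝ} (hc : c ≠ 0) (z : ℝ) :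
    ∫⁻ t in Set.Iio (-2 * b / c * z), ENNReal.ofReal (weight (formMatrix a b c) !₂[z, t]) =
      ∫⁻ t in Set.Ioi 0, ENNReal.ofReal (weight (formMatrix a b c) !₂[z, t]) := by
  have hmp := Measure.measurePreserving_sub_left (volume : Measure ℝ) (-2 * b / c * z)
  have h := hmp.setLIntegral_comp_preimage (measurableSet_Iio (a := -2 * b / c * z))
    (measurable_ofReal_weight_slice a b c z)
  rw [← h]
  simp_rw [weight_reflect hc]
  congr 2
  ext t
  simp

/-! ### Ehrhard symmetrization of the half-strip -/

/-- Between two extended reals lies a real interval, which the positive density charges; finiteness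
of `μ_z` keeps the added mass strict. This makes the supremum defining `phiInv` a genuine left
inverse. -/
lemma strictMono_phi {a b c : ℝ} (hc : 0 < c) (z : ℝ) : StrictMono (phi (formMatrix a b c) z) := by
  intro s t hst
  have := isFiniteMeasure_sliceMeasure (a := a) (b := b) hc z
  obtain ⟨p, hsp, hpt⟩ := EReal.lt_iff_exists_real_btwn.1 hst
  obtain ⟨q, hpq, hqt⟩ := EReal.lt_iff_exists_real_btwn.1 hpt
  have hpq : p < q := EReal.coe_lt_coe_iff.1 hpq
  have hpos : 0 < sliceMeasure (formMatrix a b c) z (Set.Ioo p q) := by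
    rw [pos_iff_ne_zero]
    intro h0
    have hac : (volume : Measure ℝ) ≪ sliceMeasure (formMatrix a b c) z :=
      withDensity_absolutelyContinuous' (measurable_ofReal_weight_slice a b c z).aemeasurable
        (ae_of_all _ fun y => (ENNReal.ofReal_pos.2 (weight_pos _ _)).ne')
    have := hac h0
    rw [Real.volume_Ioo, ENNReal.ofReal_eq_zero] at this
    linarith
  have hdisj : Disjoint {y : ℝ | (y : EReal) < s} (Set.Ioo p q) :=
    Set.disjoint_left.2 fun y hy hy' =>
      lt_asymm (lt_trans hy hsp) (EReal.coe_lt_coe_iff.2 hy'.1)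
  calc phi (formMatrix a b c) z s
      < phi (formMatrix a b c) z s + sliceMeasure (formMatrix a b c) z (Set.Ioo p q) :=
        ENNReal.lt_add_right (measure_ne_top _ _) hpos.ne'
    _ = sliceMeasure (formMatrix a b c) z ({y : ℝ | (y : EReal) < s} ∪ Set.Ioo p q) :=
        (measure_union hdisj measurableSet_Ioo).symm
    _ ≤ phi (formMatrix a b c) z t := by
        refine measure_mono (Set.union_subset (fun y hy => lt_trans hy hst) fun y hy => ?_)
        exact (EReal.coe_lt_coe_iff.2 hy.2).trans hqt

lemma phiInv_phi {a b c : ℝ} (hc : 0 < c) (z : ℝ) (t : EReal) :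
    phiInv (formMatrix a b c) z (phi (formMatrix a b c) z t) = t := by
  simp only [phiInv, (strictMono_phi hc z).le_iff_le]
  exact csSup_Iic

lemma halfStrip_eq (α : ℝ) : halfStrip α = obliqueStrip α 0 1 := by
  ext x
  simp [halfStrip, obliqueStrip]

lemma ehrhardSymm_halfStrip {a b c : ℝ} (hc : 0 < c) (α : ℝ) :
    ehrhardSymm (formMatrix a b c) (halfStrip α) = obliqueStrip α (-2 * b / c) (-1) := by
  ext x
  by_cases hx : x 0 ∈ Set.Icc (-α) α
  · have hslice : slice (halfStrip α) (x 0) = Set.Ioi 0 := by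
      ext y
      simpa [slice, halfStrip] using fun _ => hx
    have hmass : sliceMass (formMatrix a b c) (halfStrip α) (x 0) =
        phi (formMatrix a b c) (x 0) ((-2 * b / c * x 0 : ℝ) : EReal) := by
      have hset : {y : ℝ | (y : EReal) < ((-2 * b / c * x 0 : ℝ) : EReal)} =
          Set.Iio (-2 * b / c * x 0) := by
        ext y
        exact EReal.coe_lt_coe_iff
      rw [sliceMass, hslice, phi, hset, sliceMeasure, withDensity_apply _ measurableSet_Ioi,
        withDensity_apply _ measurableSet_Iio, setLIntegral_weight_reflect hc.ne']
    simp only [ehrhardSymm, obliqueStrip, Set.mem_ofPred_eq, hmass, phiInv_phi hc, hx, true_and,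
      EReal.coe_lt_coe_iff]
    constructor <;> intro h <;> linarith
  -- Off the strip the slice mass is `φ_z(-∞) = 0`, so the symmetrized slice is empty too.
  · have hslice : slice (halfStrip α) (x 0) = ∅ := by
      ext y
      simpa [slice, halfStrip] using fun h1 h2 => absurd ⟨h1, h2⟩ hx
    have hmass : sliceMass (formMatrix a b c) (halfStrip α) (x 0) =
        phi (formMatrix a b c) (x 0) ⊥ := by
      simp [sliceMass, hslice, phi]
    simp only [ehrhardSymm, obliqueStrip, Set.mem_ofPred_eq, hmass, phiInv_phi hc, hx, false_and,
      not_lt_bot]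

/-! ### Perimeters of the half-strip and of its symmetrization -/

lemma perimeter_obliqueStrip {A : Matrix (Fin 2) (Fin 2) ℝ} {α k s : ℝ} (hα : 0 < α)
    (hs : s ^ 2 = 1) (hw : Measurable (weight A)) :
    perimeter A (obliqueStrip α k s) =
      ENNReal.ofReal (Real.sqrt A.det / Real.sqrt (2 * Real.pi)) *
        (ENNReal.ofReal (Real.sqrt (1 + k ^ 2)) *
            (∫⁻ z in Set.Ioo (-α) α, ENNReal.ofReal (weight A !₂[z, k * z])) +
          ((∫⁻ t in {t | 0 < s * (t - k * α)}, ENNReal.ofReal (weight A !₂[α, t])) +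
            ∫⁻ t in {t | 0 < s * (t - k * -α)}, ENNReal.ofReal (weight A !₂[-α, t]))) := by
  rw [perimeter, lintegral_essBoundary_obliqueStrip hα hs hw.ennreal_ofReal]

lemma setLIntegral_weight_base {a b c k : ℝ} (hk : ∀ z, weight (formMatrix a b c) !₂[z, k * z] =
      weight (formMatrix a b c) !₂[z, 0]) (α : ℝ) :
    ∫⁻ z in Set.Ioo (-α) α, ENNReal.ofReal (weight (formMatrix a b c) !₂[z, k * z]) =
      ENNReal.ofReal (∫ z in Set.Ioo (-α) α, Real.exp (-(a * z ^ 2))) := by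
  rw [ofReal_integral_eq_lintegral_ofReal]
  · simp_rw [hk, weight_formMatrix]
    simp
  · exact (Continuous.integrableOn_Icc (by fun_prop)).mono_set Set.Ioo_subset_Icc_self
  · exact ae_of_all _ fun _ => (Real.exp_pos _).le

lemma setLIntegral_weight_slice {a b c : ℝ} (hc : 0 < c) (z : ℝ) (s : Set ℝ) :
    ∫⁻ t in s, ENNReal.ofReal (weight (formMatrix a b c) !₂[z, t]) =
      ENNReal.ofReal (∫ t in s, weight (formMatrix a b c) !₂[z, t]) := by
  rw [ofReal_integral_eq_lintegral_ofReal (integrable_weight_slice hc z).integrableOn]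
  exact ae_of_all _ fun _ => (weight_pos _ _).le

/-- The Gaussian length of the base of the half-strip, up to a constant. -/
noncomputable def baseMass (a α : ℝ) : ℝ := ∫ z in Set.Ioo (-α) α, Real.exp (-(a * z ^ 2))

/-- The Gaussian length of the vertical sides of the half-strip, up to a constant. -/
noncomputable def sideMass (a b c α : ℝ) : ℝ :=
  (∫ t in Set.Ioi 0, weight (formMatrix a b c) !₂[α, t]) +
    ∫ t in Set.Ioi 0, weight (formMatrix a b c) !₂[-α, t]

lemma baseMass_pos (a : ℝ) {α : ℝ} (hα : 0 < α) : 0 < baseMass a α := by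
  rw [baseMass, ← integral_Ioc_eq_integral_Ioo, ← intervalIntegral.integral_of_le (by linarith)]
  exact intervalIntegral.intervalIntegral_pos_of_pos
    (Continuous.intervalIntegrable (by fun_prop) _ _) (fun _ => Real.exp_pos _) (by linarith)

lemma sideMass_nonneg (a b c α : ℝ) : 0 ≤ sideMass a b c α :=
  add_nonneg (integral_nonneg fun _ => (weight_pos _ _).le)
    (integral_nonneg fun _ => (weight_pos _ _).le)

lemma perimeter_halfStrip {a b c : ℝ} (hc : 0 < c) {α : ℝ} (hα : 0 < α) :
    perimeter (formMatrix a b c) (halfStrip α) =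
      ENNReal.ofReal (Real.sqrt (formMatrix a b c).det / Real.sqrt (2 * Real.pi) *
        (baseMass a α + sideMass a b c α)) := by
  have hset : ∀ β : ℝ, {t : ℝ | 0 < 1 * (t - 0 * β)} = Set.Ioi 0 := fun β => by
    ext t
    simp
  rw [halfStrip_eq, perimeter_obliqueStrip hα (one_pow 2) (continuous_weight a b c).measurable,
    setLIntegral_weight_base (by simp), hset, hset, setLIntegral_weight_slice hc,
    setLIntegral_weight_slice hc, ENNReal.ofReal_mul (by positivity),
    ENNReal.ofReal_add (baseMass_pos a hα).le (sideMass_nonneg a b c α), sideMass,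
    ENNReal.ofReal_add (integral_nonneg fun _ => (weight_pos _ _).le)
      (integral_nonneg fun _ => (weight_pos _ _).le)]
  simp [baseMass]

lemma perimeter_ehrhardSymm_halfStrip {a b c : ℝ} (hc : 0 < c) {α : ℝ} (hα : 0 < α) :
    perimeter (formMatrix a b c) (ehrhardSymm (formMatrix a b c) (halfStrip α)) =
      ENNReal.ofReal (Real.sqrt (formMatrix a b c).det / Real.sqrt (2 * Real.pi) *
        (Real.sqrt (1 + (-2 * b / c) ^ 2) * baseMass a α + sideMass a b c α)) := by
  have hset : ∀ β : ℝ, {t : ℝ | 0 < -1 * (t - -2 * b / c * β)} = Set.Iio (-2 * b / c * β) :=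
    fun β => by
      ext t
      simp
  have hbase : 0 ≤ Real.sqrt (1 + (-2 * b / c) ^ 2) * baseMass a α :=
    mul_nonneg (Real.sqrt_nonneg _) (baseMass_pos a hα).le
  rw [ehrhardSymm_halfStrip hc, perimeter_obliqueStrip hα (by norm_num)
    (continuous_weight a b c).measurable, setLIntegral_weight_base, hset, hset,
    setLIntegral_weight_reflect hc.ne', setLIntegral_weight_reflect hc.ne',
    setLIntegral_weight_slice hc, setLIntegral_weight_slice hc, ENNReal.ofReal_mul (by positivity),
    ENNReal.ofReal_add hbase (sideMass_nonneg a b c α), sideMass,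
    ENNReal.ofReal_add (integral_nonneg fun _ => (weight_pos _ _).le)
      (integral_nonneg fun _ => (weight_pos _ _).le), ENNReal.ofReal_mul (Real.sqrt_nonneg _),
    baseMass]
  intro z
  -- The oblique base is the reflection of the horizontal one, `y = 0`.
  rw [← weight_reflect hc.ne' z 0, sub_zero]

/-! ### The barycenter -/

/-- Cartesian coordinates on the plane. -/
lemma measurePreserving_plane :
    MeasurePreserving (fun p : ℝ × ℝ => (!₂[p.1, p.2] : Plane)) volume volume :=
  (PiLp.volume_preserving_toLp (Fin 2)).comp
    ((volume_preserving_finTwoArrow ℝ).symm MeasurableEquiv.finTwoArrow)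

lemma measurableEmbedding_plane :
    MeasurableEmbedding (fun p : ℝ × ℝ => (!₂[p.1, p.2] : Plane)) := by
  refine Continuous.measurableEmbedding (by fun_prop) fun p q h => ?_
  exact Prod.ext (by simpa using congrArg (fun x : Plane => x 0) h)
    (by simpa using congrArg (fun x : Plane => x 1) h)

/-- The reflection of every vertical line over `z` about the height `k z / 2`. -/
lemma measurePreserving_reflect (k : ℝ) :
    MeasurePreserving (fun p : ℝ × ℝ => (p.1, k * p.1 - p.2)) volume volume :=
  (MeasurePreserving.id volume).skew_product (g := fun z y => k * z - y)
    (by fun_prop) (ae_of_all _ fun z => (Measure.measurePreserving_sub_left volume (k * z)).map_eq)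

lemma measurableEmbedding_reflect (k : ℝ) :
    MeasurableEmbedding (fun p : ℝ × ℝ => (p.1, k * p.1 - p.2)) := by
  refine Continuous.measurableEmbedding (by fun_prop) fun p q h => ?_
  simp only [Prod.mk.injEq] at h
  refine Prod.ext h.1 ?_
  have := h.2
  rw [h.1] at this
  linarith

/-- Serves to absorb the factor `‖x‖` of the barycenter into part of the Gaussian decay. -/
lemma norm_le_exp_sq {μ : ℝ} (hμ : 0 < μ) (t : ℝ) :
    t ≤ (1 + 1 / (4 * μ)) * Real.exp (μ * t ^ 2) := by
  have h1 := Real.add_one_le_exp (μ * t ^ 2)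
  have h2 : 1 ≤ Real.exp (μ * t ^ 2) := Real.one_le_exp (by positivity)
  have h3 : t ≤ μ * t ^ 2 + 1 / (4 * μ) := by
    have : μ * t ^ 2 + 1 / (4 * μ) - t = μ * (t - 1 / (2 * μ)) ^ 2 := by
      field_simp
      ring
    nlinarith [mul_nonneg hμ.le (sq_nonneg (t - 1 / (2 * μ)))]
  have h4 : 1 / (4 * μ) ≤ 1 / (4 * μ) * Real.exp (μ * t ^ 2) :=
    le_mul_of_one_le_right (by positivity) h2
  linarith

lemma integrable_exp_neg_mul_norm_sq {μ : ℝ} (hμ : 0 < μ) :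
    Integrable fun x : Plane => Real.exp (-μ * ‖x‖ ^ 2) := by
  have h := (GaussianFourier.integrable_cexp_neg_mul_sq_norm_add (b := (μ : ℂ)) (V := Plane)
    (by simpa using hμ) 0 0).norm
  refine h.congr (ae_of_all _ fun x => ?_)
  simp only [Complex.norm_exp]
  congr 1
  simp [← Complex.ofReal_pow]

/-- For `M = A / 2`, Cayley–Hamilton gives `tr M · ⟨M x, x⟩ - det M · ‖x‖² = ‖M x‖² ≥ 0`; the two
squares given to `nlinarith` are those of the coordinates of `M x`. -/
lemma weight_le_exp_neg_norm_sq {a b c : ℝ} (ha : 0 < a) (hc : 0 < c) (x : Plane) :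
    weight (formMatrix a b c) x ≤ Real.exp (-((a * c - b ^ 2) / (a + c)) * ‖x‖ ^ 2) := by
  rw [weight_formMatrix, EuclideanSpace.norm_sq_eq, Fin.sum_univ_two, Real.norm_eq_abs,
    Real.norm_eq_abs, sq_abs, sq_abs, Real.exp_le_exp, neg_mul, neg_le_neg_iff, div_mul_eq_mul_div,
    div_le_iff₀ (by linarith)]
  nlinarith [sq_nonneg (a * x 0 + b * x 1), sq_nonneg (b * x 0 + c * x 1)]

lemma integrable_weight_smul {a b c : ℝ} (ha : 0 < a) (hc : 0 < c) (hdet : 0 < a * c - b ^ 2) :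
    Integrable fun x : Plane => weight (formMatrix a b c) x • x := by
  -- Half the available decay rate: one half pays for `‖x‖`, the other remains integrable.
  set μ : ℝ := (a * c - b ^ 2) / (a + c) / 2 with hμdef
  have hμ : 0 < μ := by positivity
  refine ((integrable_exp_neg_mul_norm_sq hμ).const_mul (1 + 1 / (4 * μ))).mono'
    ((continuous_weight a b c).smul continuous_id).aestronglyMeasurable (ae_of_all _ fun x => ?_)
  rw [norm_smul, Real.norm_of_nonneg (weight_pos _ _).le]
  calc weight (formMatrix a b c) x * ‖x‖
      ≤ Real.exp (-(μ + μ) * ‖x‖ ^ 2) * ((1 + 1 / (4 * μ)) * Real.exp (μ * ‖x‖ ^ 2)) := by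
        have h := weight_le_exp_neg_norm_sq (b := b) ha hc x
        rw [show (a * c - b ^ 2) / (a + c) = μ + μ by rw [hμdef]; ring] at h
        exact mul_le_mul h (norm_le_exp_sq hμ _) (norm_nonneg _) (Real.exp_pos _).le
    _ = (1 + 1 / (4 * μ)) * Real.exp (-μ * ‖x‖ ^ 2) := by
        rw [mul_left_comm, ← Real.exp_add]
        ring_nf

lemma barycenter_apply_one {a b c : ℝ} (ha : 0 < a) (hc : 0 < c) (hdet : 0 < a * c - b ^ 2)
    {E : Set Plane} (hE : MeasurableSet E) :
    barycenter (formMatrix a b c) E 1 =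
      Real.sqrt (formMatrix a b c).det / (2 * Real.pi) *
        ∫ x in E, weight (formMatrix a b c) x * x 1 := by
  have hm : Measurable fun x : Plane => ENNReal.ofReal
      (Real.sqrt (formMatrix a b c).det / (2 * Real.pi) * weight (formMatrix a b c) x) :=
    ((continuous_weight a b c).measurable.const_mul _).ennreal_ofReal
  have hint := (integrable_weight_smul ha hc hdet).integrableOn (s := E)
  have hb : barycenter (formMatrix a b c) E =
      (Real.sqrt (formMatrix a b c).det / (2 * Real.pi)) •
        ∫ x in E, weight (formMatrix a b c) x • x := by
    rw [barycenter, gaussMeasure, setIntegral_withDensity_eq_setIntegral_toReal_smul hm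
      (ae_of_all _ fun _ => ENNReal.ofReal_lt_top) _ hE, ← integral_smul]
    refine integral_congr_ae (ae_of_all _ fun x => ?_)
    simp only
    rw [ENNReal.toReal_ofReal (mul_nonneg (by positivity) (weight_pos _ _).le), mul_smul]
  have hproj := (EuclideanSpace.proj (𝕜 := ℝ) (1 : Fin 2)).integral_comp_comm hint
  rw [hb, PiLp.smul_apply, smul_eq_mul]
  congr 1
  simpa using hproj.symm

/-- The factor `2 y - k z = 2 (y + b z / c)` is `1 / c` times the `y`-derivative of the quadratic
form, which provides an explicit primitive. -/
lemma hasDerivAt_weight_slice {a b c : ℝ} (hc : c ≠ 0) (z y : ℝ) :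
    HasDerivAt (fun y => -(1 / c) * weight (formMatrix a b c) !₂[z, y])
      (weight (formMatrix a b c) !₂[z, y] * (2 * y - -2 * b / c * z)) y := by
  simp only [weight_formMatrix_mk]
  have h1 : HasDerivAt (fun y => -(a * z ^ 2 + 2 * b * z * y + c * y ^ 2))
      (-(2 * b * z + c * (2 * y))) y := by
    refine ((((hasDerivAt_id' y).const_mul (2 * b * z)).const_add (a * z ^ 2)).fun_add
      ((hasDerivAt_pow 2 y).const_mul c)).fun_neg.congr_deriv ?_
    simp
  refine (h1.exp.const_mul (-(1 / c))).congr_deriv ?_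
  field_simp
  ring

lemma integrable_weight_slice_mul {a b c : ℝ} (hc : 0 < c) (z : ℝ) :
    Integrable fun y => weight (formMatrix a b c) !₂[z, y] * (2 * y - -2 * b / c * z) := by
  have h := ((integrable_mul_exp_neg_mul_sq hc).comp_add_right (b * z / c)).const_mul
    (2 * Real.exp (-(a - b ^ 2 / c) * z ^ 2))
  refine h.congr (ae_of_all _ fun y => ?_)
  simp only [weight_formMatrix_mk]
  have h2 : Real.exp (-(a * z ^ 2 + 2 * b * z * y + c * y ^ 2)) =
      Real.exp (-(a - b ^ 2 / c) * z ^ 2) * Real.exp (-c * (y + b * z / c) ^ 2) := by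
    rw [← Real.exp_add]
    congr 1
    field_simp
    ring
  rw [h2, show 2 * y - -2 * b / c * z = 2 * (y + b * z / c) by ring]
  ring

lemma integral_weight_slice_mul {a b c : ℝ} (hc : 0 < c) (z : ℝ) :
    ∫ y in Set.Ioi 0, weight (formMatrix a b c) !₂[z, y] * (2 * y - -2 * b / c * z) =
      1 / c * Real.exp (-(a * z ^ 2)) := by
  have hint := (integrable_weight_slice_mul (a := a) (b := b) hc z).integrableOn (s := Set.Ioi 0)
  have hderiv := hasDerivAt_weight_slice (a := a) (b := b) hc.ne' z
  have hlim := tendsto_zero_of_hasDerivAt_of_integrableOn_Ioi (fun y _ => hderiv y) hint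
    ((integrable_weight_slice hc z).const_mul _).integrableOn
  rw [integral_Ioi_of_hasDerivAt_of_tendsto (hderiv 0).continuousAt.continuousWithinAt
    (fun y _ => hderiv y) hint hlim, weight_formMatrix_mk]
  simp

lemma measurableSet_obliqueStrip (α k s : ℝ) : MeasurableSet (obliqueStrip α k s) :=
  ((continuous_coord 0).measurable measurableSet_Icc).inter
    (isOpen_lt continuous_const (g := fun x : Plane => s * (x 1 - k * x 0))
      (by fun_prop)).measurableSet

lemma barycenter_diff {a b c : ℝ} (ha : 0 < a) (hc : 0 < c) (hdet : 0 < a * c - b ^ 2) (α : ℝ) :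
    (barycenter (formMatrix a b c) (halfStrip α) -
        barycenter (formMatrix a b c) (ehrhardSymm (formMatrix a b c) (halfStrip α))) 1 =
      Real.sqrt (formMatrix a b c).det / (2 * Real.pi) * (1 / c * baseMass a α) := by
  set k : ℝ := -2 * b / c with hk
  set w := weight (formMatrix a b c) with hw
  have hF : Integrable fun x : Plane => w x * x 1 := by
    simpa using (EuclideanSpace.proj (𝕜 := ℝ) (1 : Fin 2)).integrable_comp
      (integrable_weight_smul ha hc hdet)
  -- Coordinates composed with the fibrewise reflection: both barycenter integrals are pulled back
  -- to the same product set.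
  have hmp := measurePreserving_plane.comp (measurePreserving_reflect k)
  have hemb := measurableEmbedding_plane.comp (measurableEmbedding_reflect k)
  have hI1 : Integrable fun p : ℝ × ℝ => w !₂[p.1, p.2] * p.2 := by
    simpa [Function.comp_def] using
      (measurePreserving_plane.integrable_comp_emb measurableEmbedding_plane).2 hF
  have hI2 : Integrable fun p : ℝ × ℝ => w !₂[p.1, p.2] * (k * p.1 - p.2) := by
    have := (hmp.integrable_comp_emb hemb).2 hF
    simpa only [Function.comp_def, hk, hw, weight_reflect hc.ne', Matrix.cons_val_one,
      Matrix.cons_val_fin_one] using this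
  have h1 : ∫ x in obliqueStrip α 0 1, w x * x 1 =
      ∫ p in Set.Icc (-α) α ×ˢ Set.Ioi (0 : ℝ), w !₂[p.1, p.2] * p.2 := by
    rw [← measurePreserving_plane.setIntegral_preimage_emb measurableEmbedding_plane]
    congr 2
    ext p
    simp [obliqueStrip]
  have h2 : ∫ x in obliqueStrip α k (-1), w x * x 1 =
      ∫ p in Set.Icc (-α) α ×ˢ Set.Ioi (0 : ℝ), w !₂[p.1, p.2] * (k * p.1 - p.2) := by
    rw [← hmp.setIntegral_preimage_emb hemb]
    have hset : ((fun p : ℝ × ℝ => (!₂[p.1, p.2] : Plane)) ∘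
        fun p : ℝ × ℝ => (p.1, k * p.1 - p.2)) ⁻¹' obliqueStrip α k (-1) =
        Set.Icc (-α) α ×ˢ Set.Ioi (0 : ℝ) := by
      ext p
      simp [obliqueStrip]
    rw [hset]
    refine integral_congr_ae (ae_of_all _ fun p => ?_)
    simp only [Function.comp_def, hk, hw, weight_reflect hc.ne']
    simp
  rw [PiLp.sub_apply, ehrhardSymm_halfStrip hc, halfStrip_eq,
    barycenter_apply_one ha hc hdet (measurableSet_obliqueStrip _ _ _),
    barycenter_apply_one ha hc hdet (measurableSet_obliqueStrip _ _ _), ← mul_sub, h1, h2,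
    ← integral_sub hI1.integrableOn hI2.integrableOn]
  congr 1
  have h3 : ∀ p : ℝ × ℝ, w !₂[p.1, p.2] * p.2 - w !₂[p.1, p.2] * (k * p.1 - p.2) =
      w !₂[p.1, p.2] * (2 * p.2 - k * p.1) := fun p => by ring
  have hI3 := (hI1.sub hI2).integrableOn (s := Set.Icc (-α) α ×ˢ Set.Ioi (0 : ℝ))
  simp only [Pi.sub_def] at hI3
  simp only [h3] at hI3 ⊢
  rw [Measure.volume_eq_prod] at hI3 ⊢
  rw [setIntegral_prod _ hI3, baseMass, ← integral_Icc_eq_integral_Ioo, ← integral_const_mul]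
  refine integral_congr_ae (ae_of_all _ fun z => ?_)
  exact integral_weight_slice_mul hc z

lemma norm_act_e₂_sub (a b c : ℝ) :
    ‖act (formMatrix a b c) e₂ -
      (inner ℝ (act (formMatrix a b c) e₂) e₂ : ℝ) • e₂‖ = 2 * |b| := by
  have h : act (formMatrix a b c) e₂ -
      (inner ℝ (act (formMatrix a b c) e₂) e₂ : ℝ) • e₂ = !₂[2 * b, 0] := by
    ext i
    fin_cases i <;>
      simp [formMatrix, act, e₂, Matrix.toLpLin_apply, PiLp.inner_apply, Fin.sum_univ_two]
  rw [h, EuclideanSpace.norm_eq, Fin.sum_univ_two]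
  simp

lemma inner_e₂ (x : Plane) : inner ℝ x e₂ = x 1 := by
  simp [e₂, PiLp.inner_apply, Fin.sum_univ_two]

lemma sqrt_one_add_sq_lt {t : ℝ} (ht : 0 < t) : Real.sqrt (1 + t ^ 2) < 1 + t := by
  rw [Real.sqrt_lt' (by linarith)]
  nlinarith

end AnisoGauss

open AnisoGauss in
theorem mainTheorem6 (a b c : ℝ) (A : Matrix (Fin 2) (Fin 2) ℝ)
    (hA : A = (2 : ℝ) • !![a, b; b, c]) (hpos : A.PosDef) (hb : b ≠ 0) :
    ∃ δ : ℝ, 0 < δ ∧ ∀ α : ℝ, 0 < α → α < δ →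
      AnisoGauss.perimeter A (AnisoGauss.halfStrip α) <
        AnisoGauss.perimeter A (AnisoGauss.ehrhardSymm A (AnisoGauss.halfStrip α)) ∧
      (AnisoGauss.perimeter A (AnisoGauss.ehrhardSymm A (AnisoGauss.halfStrip α)) : EReal) <
        (AnisoGauss.perimeter A (AnisoGauss.halfStrip α) : EReal) +
          ((Real.sqrt (2 * Real.pi) *
            ‖AnisoGauss.act A AnisoGauss.e₂ -
              (inner ℝ (AnisoGauss.act A AnisoGauss.e₂) AnisoGauss.e₂ : ℝ) • AnisoGauss.e₂‖ *
            inner ℝ (AnisoGauss.barycenter A (AnisoGauss.halfStrip α) -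
              AnisoGauss.barycenter A (AnisoGauss.ehrhardSymm A (AnisoGauss.halfStrip α)))
              AnisoGauss.e₂ : ℝ) : EReal) := by
  obtain rfl : A = formMatrix a b c := hA
  have ha : 0 < a := by simpa [formMatrix] using hpos.diag_pos (i := 0)
  have hc : 0 < c := by simpa [formMatrix] using hpos.diag_pos (i := 1)
  have hdet4 : 0 < (formMatrix a b c).det := hpos.det_pos
  have hdet : 0 < a * c - b ^ 2 := by
    rw [formMatrix_det] at hdet4
    linarith
  -- The value `1` is arbitrary: the argument works for every `α > 0`.
  refine ⟨1, one_pos, fun α hα _ => ?_⟩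
  have hJ := baseMass_pos a hα
  have hV := sideMass_nonneg a b c α
  have ht : 0 < 2 * |b| / c := by positivity
  have ht2 : (-2 * b / c) ^ 2 = (2 * |b| / c) ^ 2 := by
    rw [div_pow, div_pow, mul_pow, mul_pow, sq_abs]
    norm_num
  have hπ : 0 < Real.sqrt (2 * Real.pi) := by positivity
  have hK : 0 < Real.sqrt (formMatrix a b c).det / Real.sqrt (2 * Real.pi) := by positivity
  have hP := perimeter_halfStrip (a := a) (b := b) hc hα
  have hPs := perimeter_ehrhardSymm_halfStrip (a := a) (b := b) hc hα
  have hB := barycenter_diff ha hc hdet α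
  rw [ht2] at hPs
  have hlt := sqrt_one_add_sq_lt ht
  have hgt : 1 < Real.sqrt (1 + (2 * |b| / c) ^ 2) := by
    rw [Real.lt_sqrt zero_le_one]
    nlinarith
  set K := Real.sqrt (formMatrix a b c).det / Real.sqrt (2 * Real.pi) with hKdef
  set r := Real.sqrt (1 + (2 * |b| / c) ^ 2)
  -- The correction term equals `K |k| J`, with the same prefactor `K` as the perimeters.
  have hconst : Real.sqrt (2 * Real.pi) * (2 * |b|) *
      (Real.sqrt (formMatrix a b c).det / (2 * Real.pi) * (1 / c * baseMass a α)) =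
      K * (2 * |b| / c * baseMass a α) := by
    have hsq : Real.sqrt (2 * Real.pi) ^ 2 = 2 * Real.pi := Real.sq_sqrt (by positivity)
    rw [hKdef, show Real.sqrt (formMatrix a b c).det / (2 * Real.pi) =
      Real.sqrt (formMatrix a b c).det / Real.sqrt (2 * Real.pi) ^ 2 by rw [hsq]]
    field_simp
  rw [hP, hPs, norm_act_e₂_sub, inner_e₂, hB, hconst]
  constructor
  · rw [ENNReal.ofReal_lt_ofReal_iff (by positivity)]
    exact mul_lt_mul_of_pos_left (by nlinarith) hK
  · rw [EReal.coe_ennreal_ofReal, EReal.coe_ennreal_ofReal, max_eq_left (by positivity),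
      max_eq_left (by positivity), ← EReal.coe_add, EReal.coe_lt_coe_iff, ← mul_add]
    exact mul_lt_mul_of_pos_left (by nlinarith) hK
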